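/- Let $G$ be a (finite-dimensional, real, smooth) Lie group with Lie algebra $\mathfrak g$ of left-invariant vector fields, and let $g^1,g^2$ be left-invariant Riemannian metrics on $G$, with Levi-Civita connections $\nabla^1,\nabla^2$ and induced inner products $\langle\cdot,\cdot\rangle_1,\langle\cdot,\cdot\rangle_2$ on $\mathfrak g$. Let $TG$ be the tangent Lie group, whose multiplication is the tangent map of the multiplication of $G$. For a vector field $X$ on $G$ let $X^v$ be its vertical lift to $TG$, $X^v(y)=\frac{d}{dt}\big|_{t=0}(y+tX(x))$ for $y\in T_xG$, and let $X^c$ be its complete lift, the vector field on $TG$ whose flow is the tangent flow $T\varphi_t$ of the flow $\varphi_t$ of $X$. Let $\tilde g$ be the left-invariant Riemannian metric on $TG$ with $$\tilde g(X^c,Y^c)=g^1(X,Y),\qquad \tilde g(X^v,Y^v)=g^2(X,Y),\qquad \tilde g(X^c,Y^v)=0\qquad(X,Y\in\mathfrak g),$$ and let $\tilde\nabla$ be its Levi-Civita connection. For $X\in\mathfrak g$ let $(\mathrm{ad}_2X)^*:\mathfrak g\to\mathfrak g$ be the transpose of $\mathrm{ad}X$ with respect to $g^2$, i.e. $\langle(\mathrm{ad}_2X)^*Y,Z\rangle_2=\langle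 Y,[X,Z]\rangle_2$, and let $\varphi:\mathfrak g\to\mathfrak g$ be the linear map, symmetric for $\langle\cdot,\cdot\rangle_1$, with $\langle X,Y\rangle_2=\langle\varphi X,Y\rangle_1$. Then for all $X,Y\in\mathfrak g$, on all of $TG$: 1. $\tilde\nabla_{X^c}Y^c=\big(\nabla^1_XY\big)^c$; 2. $\tilde\nabla_{X^c}Y^v=\big(\nabla^2_XY+\tfrac12(\mathrm{ad}_2Y)^*X\big)^v$; 3. $\tilde\nabla_{X^v}Y^c=\big(\nabla^2_XY+\tfrac12(\mathrm{ad}_2X)^*Y\big)^v$; 4. $\tilde\nabla_{X^v}Y^v=\Big(\varphi\big(\nabla^2_XY-\tfrac12[X,Y]\big)\Big)^c$. (Here $\nabla^2_XY$ is again left invariant, so that $\varphi$ applies to it.) -/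

import Mathlib

open Bundle VectorField
open scoped Manifold ContDiff

noncomputable section

variable {E : Type*} [NormedAddCommGroup E] [NormedSpace ℝ E]
  {H : Type*} [TopologicalSpace H] {I : ModelWithCorners ℝ E H}

namespace TangentLie

section Lifts

variable {M : Type*} [TopologicalSpace M] [ChartedSpace H M] [IsManifold I 1 M]

/-- The vertical lift `V^v` of a vector field `V` on `M`: its value at `y ∈ T_x M` is the velocity
at `t = 0` of the curve `t ↦ y + t V(x)` in the fibre `T_x M ⊆ TM`, i.e. the image of `V x` under
the derivative at `y` of the inclusion of the fibre. -/
def verticalLift (V : Π x : M, TangentSpace I x) (p : TangentBundle I M) :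
    TangentSpace I.tangent p :=
  mfderiv 𝓘(ℝ, E) I.tangent
    (fun w : E => (TotalSpace.mk' E p.proj (w : TangentSpace I p.proj) : TangentBundle I M))
    p.snd (V p.proj)

/-- The complete lift `V^c` of a vector field `V` on `M`: the vector field on `TM` whose flow is the
tangent flow `T φ_t` of the flow `φ_t` of `V`. Its value at `y ∈ T_x M` is
`d/dt|₀ T φ_t (y) = κ (T V (y))`, where `T V : TM → T(TM)` is the tangent map of the section
`V : M → TM`, and `κ` is the canonical flip of `T(TM)`. In the coordinates of `TM` induced by the
chart of `M` at `x` (which are the ones that identify the tangent space of `TM` at any point over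
`x` with `E × E`) one has `T V (y) = (V x; y, DV(y))` and `V^c (y) = (y; V x, DV(y))`, which is
the formula `V^c = V^i ∂/∂x^i + y^j (∂V^i/∂x^j) ∂/∂y^i`. -/
def completeLift (V : Π x : M, TangentSpace I x) (p : TangentBundle I M) :
    TangentSpace I.tangent p :=
  let w : E × E := mfderiv I I.tangent
    (fun x : M => (TotalSpace.mk' E x (V x) : TangentBundle I M)) p.proj p.snd
  ((V p.proj, w.2) : E × E)

end Lifts

section TangentGroup

variable {G : Type*} [TopologicalSpace G] [ChartedSpace H G] [Group G]

theorem tangentMap_one (v : TangentBundle I G) :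
    tangentMap I I (fun _ : G => (1 : G)) v = (⟨1, 0⟩ : TangentBundle I G) := by
  simp only [tangentMap, mfderiv_const]
  rfl

variable [LieGroup I ∞ G]

/-- The tangent map `T μ` of the multiplication of `G`, for `T(G × G) ≅ TG × TG`:
`T μ (v, w) = T_h L_g w + T_g R_h v` for `v ∈ T_g G` and `w ∈ T_h G`. -/
instance : Mul (TangentBundle I G) where
  mul v w := ⟨v.proj * w.proj,
    mfderiv I I (fun h => v.proj * h) w.proj w.snd +
      mfderiv I I (fun g => g * w.proj) v.proj v.snd⟩

instance : One (TangentBundle I G) where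
  one := ⟨1, 0⟩

instance : Inv (TangentBundle I G) where
  inv v := tangentMap I I (fun g => g⁻¹) v

theorem mul_eq_tangentMap (v w : TangentBundle I G) :
    v * w = tangentMap (I.prod I) I (fun z : G × G => z.1 * z.2)
      ((equivTangentBundleProd I G I G).symm (v, w)) := by
  have h := mfderiv_prod_eq_add_apply (I := I) (I' := I) (I'' := I)
    (f := fun z : G × G => z.1 * z.2) (p := (v.proj, w.proj)) (v := (v.snd, w.snd))
    ((contMDiff_mul I ∞).mdifferentiableAt (by simp))
  rw [add_comm] at h
  exact (congrArg (TotalSpace.mk (v.proj * w.proj)) h).symm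

theorem tangentMap_mul {F : Type*} [NormedAddCommGroup F] [NormedSpace ℝ F]
    {K : Type*} [TopologicalSpace K] {J : ModelWithCorners ℝ F K}
    {N : Type*} [TopologicalSpace N] [ChartedSpace K N] {a b : N → G}
    (ha : MDifferentiable J I a) (hb : MDifferentiable J I b) (p : TangentBundle J N) :
    tangentMap J I a p * tangentMap J I b p = tangentMap J I (fun x => a x * b x) p := by
  have h1 : (fun x => a x * b x) = (fun z : G × G => z.1 * z.2) ∘ (fun x => (a x, b x)) := rfl
  rw [mul_eq_tangentMap, h1, tangentMap_comp_at p
    ((contMDiff_mul I ∞).mdifferentiableAt (by simp)) ((ha _).prodMk (hb _))]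
  congr 1
  simp only [tangentMap, equivTangentBundleProd]
  rw [mfderiv_prodMk (ha _) (hb _)]
  rfl

/-- The tangent Lie group `(TG, T μ)`, with identity `0_e` and inversion `T ι`. -/
instance : Group (TangentBundle I G) where
  mul_assoc u v w := by
    let p : TangentBundle (I.prod (I.prod I)) (G × G × G) :=
      ⟨(u.proj, v.proj, w.proj), (u.snd, v.snd, w.snd)⟩
    have hf1 : MDifferentiable (I.prod (I.prod I)) I (fun x : G × G × G => x.1) :=
      mdifferentiable_fst
    have hf2 : MDifferentiable (I.prod (I.prod I)) I (fun x : G × G × G => x.2.1) :=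
      mdifferentiable_fst.comp mdifferentiable_snd
    have hf3 : MDifferentiable (I.prod (I.prod I)) I (fun x : G × G × G => x.2.2) :=
      mdifferentiable_snd.comp mdifferentiable_snd
    have hm {a b : G × G × G → G} (ha : MDifferentiable (I.prod (I.prod I)) I a)
        (hb : MDifferentiable (I.prod (I.prod I)) I b) :
        MDifferentiable (I.prod (I.prod I)) I (fun x => a x * b x) := fun x =>
      ((contMDiff_mul I ∞ (G := G)).mdifferentiableAt (by simp)).comp x ((ha x).prodMk (hb x))
    have hu : tangentMap (I.prod (I.prod I)) I (fun x : G × G × G => x.1) p = u := by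
      simp only [tangentMap, mfderiv_fst]
      rfl
    have hv : tangentMap (I.prod (I.prod I)) I (fun x : G × G × G => x.2.1) p = v := by
      have : (fun x : G × G × G => x.2.1) = Prod.fst ∘ Prod.snd := rfl
      rw [this, tangentMap_comp_at (I' := I.prod I) p mdifferentiableAt_fst mdifferentiableAt_snd]
      simp only [tangentMap, mfderiv_fst, mfderiv_snd]
      rfl
    have hw : tangentMap (I.prod (I.prod I)) I (fun x : G × G × G => x.2.2) p = w := by
      have : (fun x : G × G × G => x.2.2) = Prod.snd ∘ Prod.snd := rfl
      rw [this, tangentMap_comp_at (I' := I.prod I) p mdifferentiableAt_snd mdifferentiableAt_snd]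
      simp only [tangentMap, mfderiv_snd]
      rfl
    rw [← hu, ← hv, ← hw, tangentMap_mul hf1 hf2, tangentMap_mul (hm hf1 hf2) hf3,
      tangentMap_mul hf2 hf3, tangentMap_mul hf1 (hm hf2 hf3)]
    simp only [mul_assoc]
  one_mul v := by
    have h := tangentMap_mul (I := I) (G := G) (J := I) (N := G) (a := fun _ => 1) (b := id)
      mdifferentiable_const mdifferentiable_id v
    simpa [tangentMap_one, ← Function.id_def, tangentMap_id] using! h
  mul_one v := by
    have h := tangentMap_mul (I := I) (G := G) (J := I) (N := G) (a := id) (b := fun _ => 1)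
      mdifferentiable_id mdifferentiable_const v
    simpa [tangentMap_one, ← Function.id_def, tangentMap_id] using! h
  inv_mul_cancel v := by
    have h := tangentMap_mul (I := I) (G := G) (J := I) (N := G) (a := fun g => g⁻¹) (b := id)
      ((contMDiff_inv I ∞).mdifferentiable (by simp)) mdifferentiable_id v
    simpa [tangentMap_one, tangentMap_id] using! h

instance : LieGroup I.tangent ∞ (TangentBundle I G) where
  contMDiff_mul := by
    have h : ContMDiff (I.tangent.prod I.tangent) I.tangent ∞
        ((tangentMap (I.prod I) I (fun z : G × G => z.1 * z.2)) ∘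
          (equivTangentBundleProd I G I G).symm) :=
      ((contMDiff_mul I ∞).contMDiff_tangentMap (m := ∞) (by simp)).comp
        contMDiff_equivTangentBundleProd_symm
    convert! h using 1
    funext z
    exact mul_eq_tangentMap z.1 z.2
  contMDiff_inv := (contMDiff_inv I ∞).contMDiff_tangentMap (m := ∞) (by simp)

end TangentGroup

section Metrics

variable [FiniteDimensional ℝ E]

instance {M : Type*} [TopologicalSpace M] [ChartedSpace H M] (x : M) :
    FiniteDimensional ℝ (TangentSpace I x) :=
  inferInstanceAs (FiniteDimensional ℝ E)

section LeviCivita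

variable {M : Type*} [TopologicalSpace M] [ChartedSpace H M] [IsManifold I ∞ M]

/-- `∇` is the Levi-Civita connection of the Riemannian metric `g` on `M`: it is compatible with
the metric, i.e. `v (g(Y, Z)) = g(∇_v Y, Z) + g(Y, ∇_v Z)`, and it is torsion-free. (In Mathlib
`nabla Y x v` is `∇_v Y` for `v ∈ T_x M`.) -/
structure IsLeviCivita (g : ContMDiffRiemannianMetric I ∞ E (TangentSpace I : M → Type _))
    (nabla : CovariantDerivative I E (TangentSpace I : M → Type _)) : Prop where
  compatible {x : M} {Y Z : Π x : M, TangentSpace I x}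
    (hY : MDifferentiableAt I I.tangent
      (fun y => (TotalSpace.mk' E y (Y y) : TangentBundle I M)) x)
    (hZ : MDifferentiableAt I I.tangent
      (fun y => (TotalSpace.mk' E y (Z y) : TangentBundle I M)) x) (v : TangentSpace I x) :
    mvfderiv I (fun y => g.inner y (Y y) (Z y)) x v =
      g.inner x (nabla Y x v) (Z x) + g.inner x (Y x) (nabla Z x v)
  torsion_free : nabla.torsion = 0

end LeviCivita

section LeftInvariant

variable {G : Type*} [TopologicalSpace G] [ChartedSpace H G] [Group G] [LieGroup I ∞ G]

/-- A Riemannian metric on a Lie group is left invariant if all left translations are isometries. -/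
def IsLeftInvariant (g : ContMDiffRiemannianMetric I ∞ E (TangentSpace I : G → Type _)) : Prop :=
  ∀ (a x : G) (u v : TangentSpace I x),
    g.inner (a * x) (mfderiv I I (fun y => a * y) x u) (mfderiv I I (fun y => a * y) x v) =
      g.inner x u v

/-- The inner product `⟨X, Y⟩ = g(X, Y)` on the Lie algebra `𝔤 = T_e G`. -/
def lieInner (g : ContMDiffRiemannianMetric I ∞ E (TangentSpace I : G → Type _)) :
    LinearMap.BilinForm ℝ (GroupLieAlgebra I G) :=
  LinearMap.mk₂ ℝ (fun X Y => g.inner 1 X Y) (by simp) (by simp) (by simp) (by simp)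

theorem lieInner_nondegenerate
    (g : ContMDiffRiemannianMetric I ∞ E (TangentSpace I : G → Type _)) :
    (lieInner g).Nondegenerate := by
  refine ⟨fun X hX => ?_, fun X hX => ?_⟩ <;>
    exact by_contra fun h => (g.pos 1 X h).ne' (hX X)

/-- The map `φ : 𝔤 → 𝔤` with `⟨X, Y⟩₂ = ⟨φ X, Y⟩₁`. -/
def phi (g₁ g₂ : ContMDiffRiemannianMetric I ∞ E (TangentSpace I : G → Type _)) :
    GroupLieAlgebra I G →ₗ[ℝ] GroupLieAlgebra I G :=
  (lieInner g₂).symmCompOfNondegenerate (lieInner g₁) (lieInner_nondegenerate g₁)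

theorem phi_spec (g₁ g₂ : ContMDiffRiemannianMetric I ∞ E (TangentSpace I : G → Type _))
    (X Y : GroupLieAlgebra I G) : lieInner g₁ (phi g₁ g₂ X) Y = lieInner g₂ X Y :=
  LinearMap.BilinForm.symmCompOfNondegenerate_left_apply _ _ _ _

instance : LieGroup I (minSmoothness ℝ 3) G :=
  .of_le (n := ∞) (by simpa using ENat.LEInfty.out)

/-- The transpose `(ad X)^*` of `ad X : 𝔤 → 𝔤` with respect to the inner product of `g`. -/
def adTranspose (g : ContMDiffRiemannianMetric I ∞ E (TangentSpace I : G → Type _))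
    (X : GroupLieAlgebra I G) : GroupLieAlgebra I G →ₗ[ℝ] GroupLieAlgebra I G :=
  (lieInner g).leftAdjointOfNondegenerate (lieInner_nondegenerate g)
    (LieAlgebra.ad ℝ (GroupLieAlgebra I G) X)

theorem adTranspose_spec (g : ContMDiffRiemannianMetric I ∞ E (TangentSpace I : G → Type _))
    (X Y Z : GroupLieAlgebra I G) :
    lieInner g (adTranspose g X Y) Z = lieInner g Y ⁅X, Z⁆ :=
  LinearMap.BilinForm.isAdjointPairLeftAdjointOfNondegenerate _ _ _ _ _

/-- The field `∇_X Y` on `G`, for the left-invariant fields determined by `X, Y ∈ 𝔤`. -/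
def covField (nabla : CovariantDerivative I E (TangentSpace I : G → Type _))
    (X Y : GroupLieAlgebra I G) (x : G) : TangentSpace I x :=
  nabla (mulInvariantVectorField Y) x (mulInvariantVectorField X x)

/-- `gT` is the left-invariant metric on the tangent Lie group `TG` given by `g₁` on complete
lifts and by `g₂` on vertical lifts of left-invariant fields, the two kinds of lifts being
orthogonal. -/
structure IsLiftedMetric
    (g₁ g₂ : ContMDiffRiemannianMetric I ∞ E (TangentSpace I : G → Type _))
    (gT : ContMDiffRiemannianMetric I.tangent ∞ (E × E)
      (TangentSpace I.tangent : TangentBundle I G → Type _)) : Prop where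
  leftInvariant : IsLeftInvariant gT
  complete_complete (X Y : GroupLieAlgebra I G) (p : TangentBundle I G) :
    gT.inner p (completeLift (mulInvariantVectorField X) p)
      (completeLift (mulInvariantVectorField Y) p) = lieInner g₁ X Y
  vertical_vertical (X Y : GroupLieAlgebra I G) (p : TangentBundle I G) :
    gT.inner p (verticalLift (mulInvariantVectorField X) p)
      (verticalLift (mulInvariantVectorField Y) p) = lieInner g₂ X Y
  complete_vertical (X Y : GroupLieAlgebra I G) (p : TangentBundle I G) :
    gT.inner p (completeLift (mulInvariantVectorField X) p)
      (verticalLift (mulInvariantVectorField Y) p) = 0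

end LeftInvariant

end Metrics

end TangentLie
end

open TangentLie

/-! The lifts of left-invariant fields have constant mutual inner products, so the derivative terms
of the Koszul formula vanish and `2⟨∇_A B, C⟩ = ⟨[A,B],C⟩ - ⟨[B,C],A⟩ + ⟨[C,A],B⟩`
(`IsLeviCivita.koszul_of_const`). Complete and vertical lifts span every tangent space of `TG`, so
it suffices to pair each side of the four formulas with them (`eq_of_inner_fields`).

The brackets are `[X^c,Y^c] = [X,Y]^c`, `[X^c,Y^v] = [X,Y]^v` and `[X^v,Y^v] = 0`. The Koszul
formula on `TG` thus becomes the one on `𝔤`, except that with two vertical arguments one term is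
lost to `[X^v,Y^v] = 0`. The transposes of `ad` and the `½[X,Y]` account for that term, and `φ`
converts `g²` into `g¹` where a vertical pairing must be written as a complete one.

The brackets are computed on functions. A tangent vector of `TM` is determined by its action on `k ∘
π` and on the differential `dk : TM → F`, where `k` is a chart of `M` (`tangent_ext`). There `V^v(k
∘ π) = 0`, `V^c(k ∘ π) = (Vk) ∘ π`, `V^v(dk) = (Vk) ∘ π` and `V^c(dk) = d(Vk)`, and the bracket acts
as a commutator (`mvfderiv_mlieBracket`). -/

noncomputable section

variable {E : Type*} [NormedAddCommGroup E] [NormedSpace ℝ E]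
  {H : Type*} [TopologicalSpace H] {I : ModelWithCorners ℝ E H}

namespace TangentLie

/-! ### Derivatives in charts, and the bracket as a commutator of derivations -/

section Charts

variable {M : Type*} [TopologicalSpace M] [ChartedSpace H M]
  {F : Type*} [NormedAddCommGroup F] [NormedSpace ℝ F] [I.Boundaryless]

theorem mvfderiv_eq_fderiv_chart {k : M → F} {x : M} (hk : MDifferentiableAt I 𝓘(ℝ, F) k x) :
    mvfderiv I k x = fderiv ℝ (k ∘ (extChartAt I x).symm) (extChartAt I x x) := by
  have h := hk.mfderiv
  rw [I.range_eq_univ, fderivWithin_univ] at h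
  exact h

theorem contDiffAt_comp_extChartAt_symm {k : M → F} {x : M} {n : ℕ∞ω}
    (hk : ContMDiffAt I 𝓘(ℝ, F) n k x) :
    ContDiffAt ℝ n (k ∘ (extChartAt I x).symm) (extChartAt I x x) := by
  have h := (contMDiffAt_iff.1 hk).2
  rw [I.range_eq_univ, contDiffWithinAt_univ] at h
  exact h

omit [I.Boundaryless] in
theorem eventually_mdifferentiableAt [IsManifold I 1 M] {k : M → F} {x : M}
    (hk : ContMDiffAt I 𝓘(ℝ, F) 1 k x) :
    ∀ᶠ y in nhds x, MDifferentiableAt I 𝓘(ℝ, F) k y := by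
  filter_upwards [(contMDiffAt_iff_contMDiffAt_nhds (by simp)).1 hk] with y hy using hy.mdifferentiableAt one_ne_zero

theorem mvfderiv_mfderivWithin_symm [IsManifold I 1 M] {k : M → F} {x : M} {z : E}
    (hz : z ∈ (extChartAt I x).target)
    (hk : MDifferentiableAt I 𝓘(ℝ, F) k ((extChartAt I x).symm z)) (w : E) :
    mvfderiv I k ((extChartAt I x).symm z)
      (mfderivWithin 𝓘(ℝ, E) I (extChartAt I x).symm (Set.range I) z w) =
      fderiv ℝ (k ∘ (extChartAt I x).symm) z w := by
  have h := mfderiv_comp_mfderivWithin (I := 𝓘(ℝ, E)) z hk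
    (mdifferentiableWithinAt_extChartAt_symm hz)
    (by rw [I.range_eq_univ]; exact uniqueMDiffWithinAt_univ 𝓘(ℝ, E))
  have h2 : mfderivWithin 𝓘(ℝ, E) 𝓘(ℝ, F) (k ∘ (extChartAt I x).symm) (Set.range I) z =
      fderiv ℝ (k ∘ (extChartAt I x).symm) z := by
    rw [I.range_eq_univ, mfderivWithin_univ, mfderiv_eq_fderiv]
  rw [h2] at h
  rw [h]
  rfl

/-- By the product rule both iterated derivatives contain `D²k` on the two fields; symmetry of `D²k`
cancels these terms. -/
theorem fderiv_lieBracket {k : E → F} {u : E} (hk : ContDiffAt ℝ 2 k u) {a b : E → E}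
    (ha : DifferentiableAt ℝ a u) (hb : DifferentiableAt ℝ b u) :
    fderiv ℝ k u (lieBracket ℝ a b u) =
      fderiv ℝ (fun z => fderiv ℝ k z (b z)) u (a u) -
        fderiv ℝ (fun z => fderiv ℝ k z (a z)) u (b u) := by
  have hdd : DifferentiableAt ℝ (fderiv ℝ k) u :=
    (hk.fderiv_right (m := 1) (by norm_num)).differentiableAt one_ne_zero
  have hsymm := (hk.isSymmSndFDerivAt (by simp)).eq (a u) (b u)
  simp [fderiv_clm_apply hdd ha, fderiv_clm_apply hdd hb, lieBracket, hsymm]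

/-- The Lie bracket of two vector fields acts on functions as their commutator. -/
theorem mvfderiv_mlieBracket [IsManifold I 2 M] [CompleteSpace E] {k : M → F} {x : M}
    (hk : ContMDiffAt I 𝓘(ℝ, F) 2 k x) {A B : Π x : M, TangentSpace I x}
    (hA : MDifferentiableAt I I.tangent (fun y => (TotalSpace.mk' E y (A y) : TangentBundle I M)) x)
    (hB : MDifferentiableAt I I.tangent (fun y => (TotalSpace.mk' E y (B y) : TangentBundle I M)) x)
    (hkA : MDifferentiableAt I 𝓘(ℝ, F) (fun y => mvfderiv I k y (A y)) x)
    (hkB : MDifferentiableAt I 𝓘(ℝ, F) (fun y => mvfderiv I k y (B y)) x) :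
    mvfderiv I k x (mlieBracket I A B x) =
      mvfderiv I (fun y => mvfderiv I k y (B y)) x (A x) -
        mvfderiv I (fun y => mvfderiv I k y (A y)) x (B x) := by
  have : IsManifold I 1 M := .of_le (n := 2) (by norm_num)
  have hk2 := contDiffAt_comp_extChartAt_symm hk
  have hev : ∀ᶠ z in nhds (extChartAt I x x), z ∈ (extChartAt I x).target ∧
      MDifferentiableAt I 𝓘(ℝ, F) k ((extChartAt I x).symm z) := by
    refine Filter.Eventually.and (extChartAt_target_mem_nhds x) ?_
    have := (continuousAt_extChartAt_symm (I := I) x).tendsto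
    rw [extChartAt_to_inv] at this
    exact this.eventually (eventually_mdifferentiableAt (hk.of_le (by norm_num)))
  -- The field pulled back to the chart at `x`: it keeps its value at the centre, and
  -- differentiating along it is the chart expression of differentiating along `C`, on a whole
  -- neighbourhood, since this function is differentiated again.
  have key : ∀ {C : Π x : M, TangentSpace I x}
      (_ : MDifferentiableAt I I.tangent
        (fun y => (TotalSpace.mk' E y (C y) : TangentBundle I M)) x),
      ∃ c : E → E, c = mpullbackWithin 𝓘(ℝ, E) I (extChartAt I x).symm C (Set.range I) ∧
        DifferentiableAt ℝ c (extChartAt I x x) ∧ c (extChartAt I x x) = C x ∧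
      (fun y => mvfderiv I k y (C y)) ∘ (extChartAt I x).symm =ᶠ[nhds (extChartAt I x x)]
        fun z => fderiv ℝ (k ∘ (extChartAt I x).symm) z (c z) := by
    intro C hC
    refine ⟨_, rfl, ?_, ?_, ?_⟩
    · have := hC.mdifferentiableWithinAt (s := Set.univ)
        |>.differentiableWithinAt_mpullbackWithin_vectorField
      rw [I.range_eq_univ, Set.preimage_univ, Set.univ_inter] at this
      rw [I.range_eq_univ]
      exact differentiableWithinAt_univ.1 this
    · have := mfderivWithin_extChartAt_symm_inverse_apply (I := I) (x := x) (C x)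
      have h2 : (extChartAt I x).symm (extChartAt I x x) = x := extChartAt_to_inv x
      rw [mpullbackWithin_apply]
      exact (congrArg (fun y => ((mfderivWithin 𝓘(ℝ, E) I (extChartAt I x).symm (Set.range I)
        (extChartAt I x x)).inverse : E →L[ℝ] E) (C y)) h2).trans this
    · filter_upwards [hev] with z hz
      have hi := isInvertible_mfderivWithin_extChartAt_symm hz.1
      exact (congrArg (mvfderiv I k ((extChartAt I x).symm z))
        (hi.self_apply_inverse (C ((extChartAt I x).symm z))).symm).trans
        (mvfderiv_mfderivWithin_symm hz.1 hz.2 _)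
  obtain ⟨a, ha, hda, hax, hka⟩ := key hA
  obtain ⟨b, hb, hdb, hbx, hkb⟩ := key hB
  have hbr : mlieBracket I A B x = lieBracket ℝ a b (extChartAt I x x) := by
    rw [← mlieBracketWithin_univ, mlieBracketWithin_apply, ← ha, ← hb, I.range_eq_univ,
      Set.preimage_univ, Set.univ_inter, lieBracketWithin_univ]
    -- The bracket is transported back by the derivative of the chart at its own centre, which is
    -- the identity.
    have h1 : (mfderiv I 𝓘(ℝ, E) (extChartAt I x) x : E →L[ℝ] E).inverse =
        ContinuousLinearMap.id ℝ E := by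
      have := mfderiv_extChartAt_self (I := I) (x := x)
      exact (congrArg (fun T : E →L[ℝ] E => T.inverse) this).trans ContinuousLinearMap.inverse_id
    exact congrArg (fun T : E →L[ℝ] E => T (lieBracket ℝ a b (extChartAt I x x))) h1
  rw [mvfderiv_eq_fderiv_chart hkB, mvfderiv_eq_fderiv_chart hkA,
    mvfderiv_eq_fderiv_chart (hk.mdifferentiableAt two_ne_zero), hka.fderiv_eq, hkb.fderiv_eq,
    hbr, ← hax, ← hbx]
  exact fderiv_lieBracket hk2 hda hdb

end Charts

/-! ### Chain rules for vector-valued functions -/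

section ChainRule

variable {M : Type*} [TopologicalSpace M] [ChartedSpace H M]
  {F : Type*} [NormedAddCommGroup F] [NormedSpace ℝ F]
  {F' : Type*} [NormedAddCommGroup F'] [NormedSpace ℝ F']
  {E' : Type*} [NormedAddCommGroup E'] [NormedSpace ℝ E']
  {H' : Type*} [TopologicalSpace H'] {J : ModelWithCorners ℝ E' H'}
  {N : Type*} [TopologicalSpace N] [ChartedSpace H' N]

theorem mvfderiv_comp_apply {k : N → F} {m : M → N} {x : M}
    (hk : MDifferentiableAt J 𝓘(ℝ, F) k (m x)) (hm : MDifferentiableAt I J m x)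
    (v : TangentSpace I x) :
    mvfderiv I (fun y => k (m y)) x v = mvfderiv J k (m x) (mfderiv I J m x v) :=
  DFunLike.congr_fun (mfderiv_comp x hk hm) v

theorem mvfderiv_fderiv_comp_apply {φ : F → F'} {m : M → F} {x : M}
    (hφ : DifferentiableAt ℝ φ (m x)) (hm : MDifferentiableAt I 𝓘(ℝ, F) m x)
    (v : TangentSpace I x) :
    mvfderiv I (fun y => φ (m y)) x v = fderiv ℝ φ (m x) (mvfderiv I m x v) := by
  have h := DFunLike.congr_fun (mfderiv_comp x hφ.mdifferentiableAt hm) v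
  rw [mfderiv_eq_fderiv] at h
  exact h

theorem mvfderiv_congr {k l : M → F} {x : M} (h : k =ᶠ[nhds x] l) (v : TangentSpace I x) :
    mvfderiv I k x v = mvfderiv I l x v :=
  DFunLike.congr_fun (h.mfderiv_eq (I := I) (I' := 𝓘(ℝ, F))) v

theorem mvfderiv_extChartAt_self [IsManifold I 1 M] (x : M) (v : TangentSpace I x) :
    mvfderiv I (extChartAt I x) x v = v :=
  DFunLike.congr_fun (mfderiv_extChartAt_self (I := I) (x := x)) v

end ChainRule

/-! ### Charts of the tangent bundle and differentials as functions on it -/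

section TangentCharts

variable {M : Type*} [TopologicalSpace M] [ChartedSpace H M] [IsManifold I ∞ M]
  {F : Type*} [NormedAddCommGroup F] [NormedSpace ℝ F] [I.Boundaryless]

/-- The differential of a function `k : M → F`, as a function on `TM`. -/
def differential (k : M → F) (p : TangentBundle I M) : F :=
  mvfderiv I k p.proj p.snd

omit [I.Boundaryless] in
-- This is why functions `k ∘ π` and `dk` suffice on `TM`: they are its coordinates when `k` is a
-- chart of `M`.
theorem extChartAt_tangent_apply {p q : TangentBundle I M}
    (hq : q.proj ∈ (chartAt H p.proj).source) :
    extChartAt I.tangent p q =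
      (extChartAt I p.proj q.proj, differential (I := I) (extChartAt I p.proj) q) := by
  have h := TangentBundle.continuousLinearMapAt_trivializationAt (I := I) hq
  have h2 := DFunLike.congr_fun h q.snd
  refine Prod.ext rfl (Eq.trans ?_ h2)
  exact (congrFun ((trivializationAt E (TangentSpace I : M → Type _) p.proj
    ).coe_linearMapAt_of_mem (R := ℝ) hq) q.snd).symm

omit [I.Boundaryless] in
theorem eventually_proj_mem_chart_source (p : TangentBundle I M) :
    ∀ᶠ q : TangentBundle I M in nhds p, q.proj ∈ (chartAt H p.proj).source :=
  (FiberBundle.continuous_proj E (TangentSpace I : M → Type _)).continuousAt.eventually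
    (chart_source_mem_nhds H p.proj)

omit [I.Boundaryless] in
theorem extChartAt_tangent_eventuallyEq (p : TangentBundle I M) :
    extChartAt I.tangent p =ᶠ[nhds p] fun q =>
      (extChartAt I p.proj q.proj, differential (I := I) (extChartAt I p.proj) q) := by
  filter_upwards [eventually_proj_mem_chart_source p] with q hq using extChartAt_tangent_apply hq

omit [I.Boundaryless] in
theorem extChartAt_tangent_self (p : TangentBundle I M) :
    extChartAt I.tangent p p = (extChartAt I p.proj p.proj, (p.snd : E)) := by
  rw [extChartAt_tangent_apply (mem_chart_source H _), differential, mvfderiv_extChartAt_self]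
  rfl

omit [IsManifold I ∞ M] [NormedAddCommGroup F] [NormedSpace ℝ F] [I.Boundaryless] in
theorem eventuallyEq_comp_extChartAt (k : M → F) (x : M) :
    k =ᶠ[nhds x] fun y => (k ∘ (extChartAt I x).symm) (extChartAt I x y) := by
  filter_upwards [extChartAt_source_mem_nhds (I := I) x] with y hy
  simp only [Function.comp_apply]
  rw [(extChartAt I x).left_inv hy]

/-- The chain rule through the chart, valid at all nearby base points because being `C¹` is an open
condition. -/
theorem differential_eventuallyEq {k : M → F} {p : TangentBundle I M}
    (hk : ContMDiffAt I 𝓘(ℝ, F) 1 k p.proj) :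
    differential (I := I) k =ᶠ[nhds p] fun q =>
      fderiv ℝ (k ∘ (extChartAt I p.proj).symm) (extChartAt I.tangent p q).1
        (extChartAt I.tangent p q).2 := by
  have h1 : ∀ᶠ y in nhds p.proj, ∀ v : TangentSpace I y, mvfderiv I k y v =
      fderiv ℝ (k ∘ (extChartAt I p.proj).symm) (extChartAt I p.proj y)
        (mvfderiv I (extChartAt I p.proj) y v) := by
    have h2 := (contDiffAt_comp_extChartAt_symm hk).eventually (by simp)
    filter_upwards [(eventuallyEq_comp_extChartAt (I := I) k p.proj).eventuallyEq_nhds,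
      chart_source_mem_nhds H p.proj, (continuousAt_extChartAt p.proj).eventually h2]
      with y hy hy2 hy3 v
    rw [mvfderiv_congr hy, mvfderiv_fderiv_comp_apply (hy3.differentiableAt one_ne_zero)
      (mdifferentiableAt_extChartAt hy2)]
  filter_upwards [(FiberBundle.continuous_proj E
    (TangentSpace I : M → Type _)).continuousAt.eventually h1,
    eventually_proj_mem_chart_source p] with q hq hq2
  rw [extChartAt_tangent_apply hq2]
  exact hq _

theorem contMDiffAt_differential {k : M → F} {p : TangentBundle I M} {n : ℕ}
    (hk : ContMDiffAt I 𝓘(ℝ, F) (n + 1) k p.proj) :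
    ContMDiffAt I.tangent 𝓘(ℝ, F) n (differential (I := I) k) p := by
  have hd : ContDiffAt ℝ n (fderiv ℝ (k ∘ (extChartAt I p.proj).symm))
      (extChartAt I.tangent p p).1 := by
    rw [extChartAt_tangent_self]
    exact (contDiffAt_comp_extChartAt_symm hk).fderiv_right le_rfl
  have hd2 : ContDiffAt ℝ n (fun z : E × E =>
      fderiv ℝ (k ∘ (extChartAt I p.proj).symm) z.1 z.2) (extChartAt I.tangent p p) :=
    (hd.comp (f := Prod.fst) (extChartAt I.tangent p p) contDiffAt_fst).clm_apply contDiffAt_snd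
  exact (hd2.contMDiffAt.comp p contMDiffAt_extChartAt).congr_of_eventuallyEq
    (differential_eventuallyEq (hk.of_le (by simp)))

theorem mdifferentiableAt_differential {k : M → F} {p : TangentBundle I M}
    (hk : ContMDiffAt I 𝓘(ℝ, F) 2 k p.proj) :
    MDifferentiableAt I.tangent 𝓘(ℝ, F) (differential (I := I) k) p :=
  (contMDiffAt_differential (n := 1) (hk.of_le (by norm_num))).mdifferentiableAt (by simp)

/-- The component of a tangent vector of `TM` along `M`. -/
def horizontal {p : TangentBundle I M} (ξ : TangentSpace I.tangent p) : TangentSpace I p.proj :=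
  Prod.fst (α := E) (β := E) ξ

/-- The component along the fibre of a tangent vector of `TM`, in the chart at its base point. -/
def vertical {p : TangentBundle I M} (ξ : TangentSpace I.tangent p) : TangentSpace I p.proj :=
  Prod.snd (α := E) (β := E) ξ

/-- The second derivative of a function at `x`, in the chart at `x`. -/
def chartHessian (k : M → F) (x : M) (v w : TangentSpace I x) : F :=
  fderiv ℝ (fderiv ℝ (k ∘ (extChartAt I x).symm)) (extChartAt I x x) v w

omit [IsManifold I ∞ M] in
theorem chartHessian_comm {k : M → F} {x : M} (hk : ContMDiffAt I 𝓘(ℝ, F) 2 k x)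
    (v w : TangentSpace I x) : chartHessian k x v w = chartHessian k x w v :=
  ((contDiffAt_comp_extChartAt_symm hk).isSymmSndFDerivAt (by simp)).eq v w

omit [IsManifold I ∞ M] [I.Boundaryless] in
theorem chartHessian_zero_left (k : M → F) (x : M) (w : TangentSpace I x) :
    chartHessian k x 0 w = 0 :=
  DFunLike.congr_fun
    (map_zero (fderiv ℝ (fderiv ℝ (k ∘ (extChartAt I x).symm)) (extChartAt I x x))) w

/-- In coordinates `dk` is `(u, w) ↦ Dk(u) w`; the product rule gives a Hessian term from moving `u`
and a linear term from moving `w`. -/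
theorem mvfderiv_differential {k : M → F} {p : TangentBundle I M}
    (hk : ContMDiffAt I 𝓘(ℝ, F) 2 k p.proj) (ξ : TangentSpace I.tangent p) :
    mvfderiv I.tangent (differential (I := I) k) p ξ =
      chartHessian k p.proj (horizontal ξ) p.snd + mvfderiv I k p.proj (vertical ξ) := by
  have hd : DifferentiableAt ℝ (fderiv ℝ (k ∘ (extChartAt I p.proj).symm))
      (extChartAt I p.proj p.proj) :=
    ((contDiffAt_comp_extChartAt_symm hk).fderiv_right (m := 1)
      (by norm_num)).differentiableAt one_ne_zero
  have hd1 : DifferentiableAt ℝ (fderiv ℝ (k ∘ (extChartAt I p.proj).symm))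
      (extChartAt I.tangent p p).1 := by rwa [extChartAt_tangent_self]
  have hd2 := hd1.hasFDerivAt.comp (extChartAt I.tangent p p) hasFDerivAt_fst
  have hd3 := hd2.clm_apply hasFDerivAt_snd
  rw [mvfderiv_congr (differential_eventuallyEq (hk.of_le (by norm_num)))]
  refine (mvfderiv_fderiv_comp_apply hd3.differentiableAt
    (mdifferentiableAt_extChartAt (mem_chart_source _ p)) _).trans ?_
  rw [mvfderiv_extChartAt_self, mvfderiv_eq_fderiv_chart (hk.mdifferentiableAt two_ne_zero)]
  refine (DFunLike.congr_fun hd3.fderiv _).trans ?_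
  rw [extChartAt_tangent_self]
  exact add_comm _ _

omit [I.Boundaryless] in
theorem mfderiv_proj_apply (p : TangentBundle I M) (ξ : TangentSpace I.tangent p) :
    mfderiv I.tangent I (TotalSpace.proj : TangentBundle I M → M) p ξ = horizontal ξ := by
  have h1 := mvfderiv_comp_apply (mdifferentiableAt_extChartAt (I := I) (mem_chart_source H p.proj))
    (Bundle.mdifferentiableAt_proj (IB := I) (TangentSpace I) (p := p)) ξ
  rw [mvfderiv_extChartAt_self] at h1
  refine h1.symm.trans ?_
  have h2 := mvfderiv_fderiv_comp_apply (φ := (Prod.fst : E × E → E)) differentiableAt_fst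
    (mdifferentiableAt_extChartAt (I := I.tangent) (mem_chart_source _ p)) ξ
  refine h2.trans ?_
  rw [mvfderiv_extChartAt_self, fderiv_fst]
  rfl

omit [I.Boundaryless] in
theorem mvfderiv_comp_proj {k : M → F} {p : TangentBundle I M}
    (hk : MDifferentiableAt I 𝓘(ℝ, F) k p.proj) (ξ : TangentSpace I.tangent p) :
    mvfderiv I.tangent (fun q : TangentBundle I M => k q.proj) p ξ =
      mvfderiv I k p.proj (horizontal ξ) := by
  rw [← mfderiv_proj_apply]
  exact mvfderiv_comp_apply hk (Bundle.mdifferentiableAt_proj (IB := I) (TangentSpace I) (p := p)) ξ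

/-- A tangent vector of `TM` is determined by its action on coordinate functions of `M` and on their
differentials. -/
theorem tangent_ext {p : TangentBundle I M} {ξ η : TangentSpace I.tangent p}
    (h1 : mvfderiv I.tangent (fun q : TangentBundle I M => extChartAt I p.proj q.proj) p ξ =
      mvfderiv I.tangent (fun q : TangentBundle I M => extChartAt I p.proj q.proj) p η)
    (h2 : mvfderiv I.tangent (differential (I := I) (extChartAt I p.proj)) p ξ =
      mvfderiv I.tangent (differential (I := I) (extChartAt I p.proj)) p η) : ξ = η := by
  have hc : ContMDiffAt I 𝓘(ℝ, E) 2 (extChartAt I p.proj) p.proj := contMDiffAt_extChartAt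
  have hh : horizontal ξ = horizontal η := by
    have hc1 := mdifferentiableAt_extChartAt (I := I) (mem_chart_source H p.proj)
    rwa [mvfderiv_comp_proj hc1, mvfderiv_comp_proj hc1, mvfderiv_extChartAt_self,
      mvfderiv_extChartAt_self] at h1
  rw [mvfderiv_differential hc, mvfderiv_differential hc, hh, mvfderiv_extChartAt_self,
      mvfderiv_extChartAt_self] at h2
  -- The Hessian term depends only on the horizontal part, so it cancels.
  exact Prod.ext hh (add_left_cancel h2)

end TangentCharts

/-! ### Action of the lifts on functions -/

section LiftDerivations

variable {M : Type*} [TopologicalSpace M] [ChartedSpace H M] [IsManifold I ∞ M]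
  {F : Type*} [NormedAddCommGroup F] [NormedSpace ℝ F] [I.Boundaryless]
  {V : Π x : M, TangentSpace I x} {p : TangentBundle I M} {k : M → F}

omit [I.Boundaryless] in
theorem mdifferentiable_totalSpace_mk (x : M) :
    MDifferentiable 𝓘(ℝ, E) I.tangent
      (fun w : E => (TotalSpace.mk' E x (w : TangentSpace I x) : TangentBundle I M)) := by
  intro w
  rw [mdifferentiableAt_totalSpace]
  refine ⟨mdifferentiableAt_const, ?_⟩
  have h : (fun w : E => (trivializationAt E (TangentSpace I : M → Type _) x
      (TotalSpace.mk' E x (w : TangentSpace I x))).2) = id := by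
    funext w
    have := congrArg Prod.snd (extChartAt_tangent_self (I := I) (M := M) ⟨x, w⟩)
    exact this
  exact h ▸ mdifferentiableAt_id

omit [I.Boundaryless] in
-- In the chart of `TM` at `p` the inclusion of the fibre is `w ↦ (const, w)`, with derivative
-- `ContinuousLinearMap.inr`.
theorem verticalLift_eq : verticalLift V p = ((0, V p.proj) : E × E) := by
  have h := mvfderiv_comp_apply (m := fun w : E =>
      (TotalSpace.mk' E p.proj (w : TangentSpace I p.proj) : TangentBundle I M)) (x := p.snd)
    (mdifferentiableAt_extChartAt (I := I.tangent) (mem_chart_source _ p))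
    (mdifferentiable_totalSpace_mk p.proj _) (V p.proj)
  have h2 : (fun w : E => extChartAt I.tangent p
      (TotalSpace.mk' E p.proj (w : TangentSpace I p.proj) : TangentBundle I M)) =
      fun w => (extChartAt I p.proj p.proj, w) := by
    funext w
    exact extChartAt_tangent_self (I := I) (M := M) ⟨p.proj, w⟩
  rw [h2] at h
  have h3 : HasFDerivAt (fun w : E => (extChartAt I p.proj p.proj, w))
    (ContinuousLinearMap.inr ℝ E E) p.snd := hasFDerivAt_prodMk_right _ _
  have h4 : mvfderiv 𝓘(ℝ, E) (fun w : E => (extChartAt I p.proj p.proj, w)) p.snd (V p.proj) =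
      ((0, V p.proj) : E × E) :=
    DFunLike.congr_fun h3.hasMFDerivAt.mfderiv (V p.proj)
  exact (h.symm.trans h4 |>.symm.trans (mvfderiv_extChartAt_self p _)).symm

omit [I.Boundaryless] in
theorem horizontal_verticalLift : horizontal (verticalLift V p) = 0 :=
  congrArg (Prod.fst (α := E) (β := E)) verticalLift_eq

omit [I.Boundaryless] in
theorem vertical_verticalLift : vertical (verticalLift V p) = V p.proj :=
  congrArg (Prod.snd (α := E) (β := E)) verticalLift_eq

omit [I.Boundaryless] in
theorem horizontal_completeLift : horizontal (completeLift V p) = V p.proj := rfl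

omit [I.Boundaryless] in
theorem vertical_completeLift : vertical (completeLift V p) =
    vertical (p := (⟨p.proj, V p.proj⟩ : TangentBundle I M)) (mfderiv I I.tangent
    (fun x : M => (TotalSpace.mk' E x (V x) : TangentBundle I M)) p.proj p.snd) := rfl

omit [I.Boundaryless] in
theorem verticalLift_comp_proj (hk : MDifferentiableAt I 𝓘(ℝ, F) k p.proj) :
    mvfderiv I.tangent (fun q : TangentBundle I M => k q.proj) p (verticalLift V p) = 0 := by
  rw [mvfderiv_comp_proj hk, horizontal_verticalLift, map_zero]

omit [I.Boundaryless] in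
theorem completeLift_comp_proj (hk : MDifferentiableAt I 𝓘(ℝ, F) k p.proj) :
    mvfderiv I.tangent (fun q : TangentBundle I M => k q.proj) p (completeLift V p) =
      mvfderiv I k p.proj (V p.proj) := by
  rw [mvfderiv_comp_proj hk, horizontal_completeLift]

theorem verticalLift_differential (hk : ContMDiffAt I 𝓘(ℝ, F) 2 k p.proj) :
    mvfderiv I.tangent (differential (I := I) k) p (verticalLift V p) =
      mvfderiv I k p.proj (V p.proj) := by
  rw [mvfderiv_differential hk, horizontal_verticalLift, vertical_verticalLift]
  rw [chartHessian_zero_left, zero_add]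

/-- With `y = p.snd`, the function `Vk` is `dk` composed with the section `V`, so `d(Vk)(y)` is the
derivative of `dk` along `TV(y)`. Compared with `V^c`, the vertical part is the same and the Hessian
arguments `V` and `y` are swapped: the canonical flip is absorbed by symmetry of the Hessian. -/
theorem completeLift_differential (hk : ContMDiffAt I 𝓘(ℝ, F) 2 k p.proj)
    (hV : MDifferentiableAt I I.tangent
      (fun x => (TotalSpace.mk' E x (V x) : TangentBundle I M)) p.proj) :
    mvfderiv I.tangent (differential (I := I) k) p (completeLift V p) =
      differential (I := I) (fun x => mvfderiv I k x (V x)) p := by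
  have h : mvfderiv I (fun x => mvfderiv I k x (V x)) p.proj p.snd = _ :=
    mvfderiv_comp_apply (m := fun x => (TotalSpace.mk' E x (V x) : TangentBundle I M))
      (mdifferentiableAt_differential (p := ⟨p.proj, V p.proj⟩) hk) hV p.snd
  have h2 := mvfderiv_differential (p := ⟨p.proj, V p.proj⟩) hk (mfderiv I I.tangent
    (fun x => (TotalSpace.mk' E x (V x) : TangentBundle I M)) p.proj p.snd)
  have h3 : horizontal (p := ⟨p.proj, V p.proj⟩) (mfderiv I I.tangent
    (fun x => (TotalSpace.mk' E x (V x) : TangentBundle I M)) p.proj p.snd) = p.snd := by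
    rw [← mfderiv_proj_apply]
    have h4 := mfderiv_comp (g := (TotalSpace.proj : TangentBundle I M → M)) p.proj
      (Bundle.mdifferentiableAt_proj (IB := I) (TangentSpace I)) hV
    have h5 : (TotalSpace.proj : TangentBundle I M → M) ∘
      (fun x => (TotalSpace.mk' E x (V x) : TangentBundle I M)) = id := rfl
    rw [h5, mfderiv_id] at h4
    exact (DFunLike.congr_fun h4 p.snd).symm
  rw [mvfderiv_differential hk, horizontal_completeLift, vertical_completeLift,
    chartHessian_comm hk]
  refine Eq.trans ?_ (h.trans h2).symm
  rw [h3]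

end LiftDerivations

/-! ### Regularity and brackets of the lifts -/

section LiftBrackets

variable {M : Type*} [TopologicalSpace M] [ChartedSpace H M] [IsManifold I ∞ M]
  {F : Type*} [NormedAddCommGroup F] [NormedSpace ℝ F] [I.Boundaryless]

/-- The derivative `V k` of a function `k` along a vector field `V`. -/
def lieDeriv (V : Π x : M, TangentSpace I x) (k : M → F) (x : M) : F :=
  mvfderiv I k x (V x)

omit [I.Boundaryless] in
-- The fibre coordinates of a field are its derivatives of the chart functions. This is applied with
-- `TM` as the manifold.
theorem mdifferentiableAt_section_of_lieDeriv_chart {V : Π x : M, TangentSpace I x} {x : M}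
    (h : MDifferentiableAt I 𝓘(ℝ, E) (lieDeriv V (extChartAt I x)) x) :
    MDifferentiableAt I I.tangent
      (fun y => (TotalSpace.mk' E y (V y) : TangentBundle I M)) x := by
  rw [mdifferentiableAt_section]
  refine h.congr_of_eventuallyEq ?_
  filter_upwards [chart_source_mem_nhds H x] with y hy
  exact congrArg Prod.snd (extChartAt_tangent_apply (I := I) (M := M) (p := ⟨x, 0⟩)
    (q := ⟨y, V y⟩) hy)

variable {V W : Π x : M, TangentSpace I x} {p : TangentBundle I M} {k : M → F}

theorem contMDiffAt_lieDeriv {n : ℕ} {x : M} (hk : ContMDiffAt I 𝓘(ℝ, F) (n + 1) k x)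
    (hV : ContMDiffAt I I.tangent n (fun y => (TotalSpace.mk' E y (V y) : TangentBundle I M)) x) :
    ContMDiffAt I 𝓘(ℝ, F) n (lieDeriv V k) x :=
  (contMDiffAt_differential (p := ⟨x, V x⟩) hk).comp x hV

theorem lieDeriv_mlieBracket [CompleteSpace E] {x : M}
    (hk : ContMDiffAt I 𝓘(ℝ, F) 2 k x)
    (hV : ContMDiffAt I I.tangent 1 (fun y => (TotalSpace.mk' E y (V y) : TangentBundle I M)) x)
    (hW : ContMDiffAt I I.tangent 1 (fun y => (TotalSpace.mk' E y (W y) : TangentBundle I M)) x) :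
    lieDeriv (mlieBracket I V W) k x =
      lieDeriv V (lieDeriv W k) x - lieDeriv W (lieDeriv V k) x :=
  mvfderiv_mlieBracket hk (hV.mdifferentiableAt one_ne_zero) (hW.mdifferentiableAt one_ne_zero)
    ((contMDiffAt_lieDeriv (n := 1) (hk.of_le (by norm_num)) hV).mdifferentiableAt (by simp))
    ((contMDiffAt_lieDeriv (n := 1) (hk.of_le (by norm_num)) hW).mdifferentiableAt (by simp))

omit [I.Boundaryless] in
theorem eventually_contMDiffAt {n : ℕ} {x : M} (hk : ContMDiffAt I 𝓘(ℝ, F) n k x) :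
    ∀ᶠ y in nhds x, ContMDiffAt I 𝓘(ℝ, F) n k y :=
  have : IsManifold I n M := .of_le (n := ∞) (by exact_mod_cast le_top)
  (contMDiffAt_iff_contMDiffAt_nhds (by simp)).1 hk

omit [I.Boundaryless] in
theorem eventually_tangentBundle {P : M → Prop} (h : ∀ᶠ y in nhds p.proj, P y) :
    ∀ᶠ q : TangentBundle I M in nhds p, P q.proj :=
  (FiberBundle.continuous_proj E (TangentSpace I : M → Type _)).continuousAt.eventually h

omit [I.Boundaryless] in
theorem contMDiffAt_comp_proj {n : ℕ∞ω} (hk : ContMDiffAt I 𝓘(ℝ, F) n k p.proj) :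
    ContMDiffAt I.tangent 𝓘(ℝ, F) n (fun q : TangentBundle I M => k q.proj) p :=
  hk.comp p (contMDiff_proj (TangentSpace I)).contMDiffAt

omit [I.Boundaryless] in
-- This and the next three rules hold near `p`, not only at `p`, because commutators differentiate
-- them once more.
theorem lieDeriv_verticalLift_comp_proj (hk : ContMDiffAt I 𝓘(ℝ, F) 2 k p.proj) :
    lieDeriv (verticalLift V) (fun q : TangentBundle I M => k q.proj) =ᶠ[nhds p] fun _ => 0 := by
  filter_upwards [eventually_tangentBundle (eventually_contMDiffAt (n := 2) hk)] with q hq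
  exact verticalLift_comp_proj (hq.mdifferentiableAt two_ne_zero)

omit [I.Boundaryless] in
theorem lieDeriv_completeLift_comp_proj (hk : ContMDiffAt I 𝓘(ℝ, F) 2 k p.proj) :
    lieDeriv (completeLift V) (fun q : TangentBundle I M => k q.proj) =ᶠ[nhds p]
      fun q => lieDeriv V k q.proj := by
  filter_upwards [eventually_tangentBundle (eventually_contMDiffAt (n := 2) hk)] with q hq
  exact completeLift_comp_proj (hq.mdifferentiableAt two_ne_zero)

theorem lieDeriv_verticalLift_differential (hk : ContMDiffAt I 𝓘(ℝ, F) 2 k p.proj) :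
    lieDeriv (verticalLift V) (differential (I := I) k) =ᶠ[nhds p]
      fun q => lieDeriv V k q.proj := by
  filter_upwards [eventually_tangentBundle (eventually_contMDiffAt (n := 2) hk)] with q hq
  exact verticalLift_differential hq

theorem lieDeriv_completeLift_differential (hk : ContMDiffAt I 𝓘(ℝ, F) 2 k p.proj)
    (hV : MDifferentiable I I.tangent
      (fun x => (TotalSpace.mk' E x (V x) : TangentBundle I M))) :
    lieDeriv (completeLift V) (differential (I := I) k) =ᶠ[nhds p]
      differential (I := I) (lieDeriv V k) := by
  filter_upwards [eventually_tangentBundle (eventually_contMDiffAt (n := 2) hk)] with q hq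
  exact completeLift_differential hq (hV _)

theorem mvfderiv_prodMk_apply {E' H' N F' : Type*} [NormedAddCommGroup E'] [NormedSpace ℝ E']
    [TopologicalSpace H'] {J : ModelWithCorners ℝ E' H'} [TopologicalSpace N] [ChartedSpace H' N]
    [NormedAddCommGroup F'] [NormedSpace ℝ F'] {a : N → F} {b : N → F'} {x : N}
    (ha : MDifferentiableAt J 𝓘(ℝ, F) a x) (hb : MDifferentiableAt J 𝓘(ℝ, F') b x)
    (v : TangentSpace J x) :
    mvfderiv J (fun y => (a y, b y)) x v = (mvfderiv J a x v, mvfderiv J b x v) := by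
  have hab := ha.prodMk_space hb
  refine Prod.ext ?_ ?_
  · exact ((DFunLike.congr_fun (fderiv_fst (𝕜 := ℝ)) _).symm.trans
      (mvfderiv_fderiv_comp_apply (φ := Prod.fst) differentiableAt_fst hab v).symm)
  · exact ((DFunLike.congr_fun (fderiv_snd (𝕜 := ℝ)) _).symm.trans
      (mvfderiv_fderiv_comp_apply (φ := Prod.snd) differentiableAt_snd hab v).symm)

theorem lieDeriv_extChartAt_tangent (A : Π q : TangentBundle I M, TangentSpace I.tangent q) :
    lieDeriv A (extChartAt I.tangent p) =ᶠ[nhds p] fun q =>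
      (lieDeriv A (fun q : TangentBundle I M => extChartAt I p.proj q.proj) q,
        lieDeriv A (differential (I := I) (extChartAt I p.proj)) q) := by
  filter_upwards [(extChartAt_tangent_eventuallyEq p).eventuallyEq_nhds,
    eventually_proj_mem_chart_source p] with q hq hq2
  have hc : ContMDiffAt I 𝓘(ℝ, E) 2 (extChartAt I p.proj) q.proj := contMDiffAt_extChartAt' hq2
  exact (mvfderiv_congr hq _).trans (mvfderiv_prodMk_apply
    ((hc.mdifferentiableAt two_ne_zero).comp q (Bundle.mdifferentiableAt_proj (TangentSpace I)))
    (mdifferentiableAt_differential hc) _)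

theorem mdifferentiableAt_verticalLift
    (hV : ContMDiff I I.tangent 1 (fun y => (TotalSpace.mk' E y (V y) : TangentBundle I M))) :
    MDifferentiableAt I.tangent I.tangent.tangent
      (fun q => (TotalSpace.mk' (E × E) q (verticalLift V q) :
        TangentBundle I.tangent (TangentBundle I M))) p := by
  have hc : ContMDiffAt I 𝓘(ℝ, E) 2 (extChartAt I p.proj) p.proj := contMDiffAt_extChartAt
  refine mdifferentiableAt_section_of_lieDeriv_chart ?_
  have h1 := (contMDiffAt_lieDeriv (n := 1) (hc.of_le (by norm_num)) hV.contMDiffAt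
    ).mdifferentiableAt (by simp)
  refine MDifferentiableAt.congr_of_eventuallyEq ?_ ((lieDeriv_extChartAt_tangent _).trans
    ((lieDeriv_verticalLift_comp_proj hc).prodMk (lieDeriv_verticalLift_differential hc)))
  exact mdifferentiableAt_const.prodMk_space
    (h1.comp p (Bundle.mdifferentiableAt_proj (TangentSpace I)))

/-- The fibre coordinate of `V^c` is `d(Vk)`, which already uses one derivative of `V`; hence `C²`
here against `C¹` for the vertical lift. -/
theorem mdifferentiableAt_completeLift
    (hV : ContMDiff I I.tangent 2 (fun y => (TotalSpace.mk' E y (V y) : TangentBundle I M))) :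
    MDifferentiableAt I.tangent I.tangent.tangent
      (fun q => (TotalSpace.mk' (E × E) q (completeLift V q) :
        TangentBundle I.tangent (TangentBundle I M))) p := by
  have hc : ContMDiffAt I 𝓘(ℝ, E) 3 (extChartAt I p.proj) p.proj := contMDiffAt_extChartAt
  have hc2 : ContMDiffAt I 𝓘(ℝ, E) 2 (extChartAt I p.proj) p.proj := contMDiffAt_extChartAt
  refine mdifferentiableAt_section_of_lieDeriv_chart ?_
  have h1 := contMDiffAt_lieDeriv (n := 2) (hc.of_le (by norm_num)) hV.contMDiffAt
  refine MDifferentiableAt.congr_of_eventuallyEq ?_ ((lieDeriv_extChartAt_tangent _).trans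
    ((lieDeriv_completeLift_comp_proj hc2).prodMk
      (lieDeriv_completeLift_differential hc2 (hV.mdifferentiable two_ne_zero))))
  exact ((h1.mdifferentiableAt (by simp)).comp p
    (Bundle.mdifferentiableAt_proj (TangentSpace I))).prodMk_space
      (mdifferentiableAt_differential h1)

theorem tangent_ext_lieDeriv {A B : Π q : TangentBundle I M, TangentSpace I.tangent q}
    (h1 : lieDeriv A (fun q : TangentBundle I M => extChartAt I p.proj q.proj) p =
      lieDeriv B (fun q : TangentBundle I M => extChartAt I p.proj q.proj) p)
    (h2 : lieDeriv A (differential (I := I) (extChartAt I p.proj)) p =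
      lieDeriv B (differential (I := I) (extChartAt I p.proj)) p) : A p = B p :=
  tangent_ext h1 h2

omit [IsManifold I ∞ M] [I.Boundaryless] in
theorem lieDeriv_const {A : Π x : M, TangentSpace I x} (c : F) (x : M) :
    lieDeriv A (fun _ => c) x = 0 :=
  DFunLike.congr_fun (mvfderiv_const c) (A x)

omit [IsManifold I ∞ M] [I.Boundaryless] in
theorem lieDeriv_congr {A : Π x : M, TangentSpace I x} {k l : M → F} {x : M}
    (h : k =ᶠ[nhds x] l) : lieDeriv A k x = lieDeriv A l x :=
  mvfderiv_congr h _

variable [CompleteSpace E]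

/-- The action of `[A, B]` on functions, where `A` and `B` need only be differentiable. -/
theorem lieDeriv_mlieBracket_eq {A B : Π x : M, TangentSpace I x} {x : M} {kA kB : M → F}
    (hk : ContMDiffAt I 𝓘(ℝ, F) 2 k x)
    (hA : MDifferentiableAt I I.tangent (fun y => (TotalSpace.mk' E y (A y) : TangentBundle I M)) x)
    (hB : MDifferentiableAt I I.tangent (fun y => (TotalSpace.mk' E y (B y) : TangentBundle I M)) x)
    (hAk : lieDeriv A k =ᶠ[nhds x] kA) (hBk : lieDeriv B k =ᶠ[nhds x] kB) :
    lieDeriv (mlieBracket I A B) k x = lieDeriv A kB x - lieDeriv B kA x := by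
  have h {C : Π x : M, TangentSpace I x} (hC : MDifferentiableAt I I.tangent
      (fun y => (TotalSpace.mk' E y (C y) : TangentBundle I M)) x) :
      MDifferentiableAt I 𝓘(ℝ, F) (lieDeriv C k) x :=
    (mdifferentiableAt_differential (p := ⟨x, C x⟩) hk).comp x hC
  rw [← lieDeriv_congr hAk, ← lieDeriv_congr hBk]
  exact mvfderiv_mlieBracket hk hA hB (h hA) (h hB)

variable
    (hV : ContMDiff I I.tangent 2 (fun y => (TotalSpace.mk' E y (V y) : TangentBundle I M)))
    (hW : ContMDiff I I.tangent 2 (fun y => (TotalSpace.mk' E y (W y) : TangentBundle I M)))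

include hV hW

/-- A vertical lift turns `k ∘ π` and `dk` into functions pulled back from `M`, and a second
vertical lift kills these. -/
theorem mlieBracket_verticalLift_verticalLift :
    mlieBracket I.tangent (verticalLift V) (verticalLift W) p = 0 := by
  have hc : ContMDiffAt I 𝓘(ℝ, E) 3 (extChartAt I p.proj) p.proj := contMDiffAt_extChartAt
  have hc2 : ContMDiffAt I 𝓘(ℝ, E) 2 (extChartAt I p.proj) p.proj := contMDiffAt_extChartAt
  have hV' := mdifferentiableAt_verticalLift (p := p) (hV.of_le (by norm_num))
  have hW' := mdifferentiableAt_verticalLift (p := p) (hW.of_le (by norm_num))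
  have hcV := contMDiffAt_lieDeriv (n := 2) (hc.of_le (by norm_num)) hV.contMDiffAt
  have hcW := contMDiffAt_lieDeriv (n := 2) (hc.of_le (by norm_num)) hW.contMDiffAt
  refine tangent_ext_lieDeriv (B := 0) ?_ ?_
  · rw [lieDeriv_mlieBracket_eq (contMDiffAt_comp_proj hc2) hV' hW'
      (lieDeriv_verticalLift_comp_proj hc2) (lieDeriv_verticalLift_comp_proj hc2),
      lieDeriv_const, lieDeriv_const, sub_zero]
    exact (map_zero _).symm
  · rw [lieDeriv_mlieBracket_eq (contMDiffAt_differential (n := 2) (hc.of_le (by norm_num))) hV' hW'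
      (lieDeriv_verticalLift_differential hc2) (lieDeriv_verticalLift_differential hc2),
      (lieDeriv_verticalLift_comp_proj hcV).eq_of_nhds,
      (lieDeriv_verticalLift_comp_proj hcW).eq_of_nhds, sub_zero]
    exact (map_zero _).symm

/-- On `k ∘ π` both sides vanish; on `dk` both give `(VWk - WVk) ∘ π`. -/
theorem mlieBracket_completeLift_verticalLift :
    mlieBracket I.tangent (completeLift V) (verticalLift W) p =
      verticalLift (mlieBracket I V W) p := by
  have hc : ContMDiffAt I 𝓘(ℝ, E) 3 (extChartAt I p.proj) p.proj := contMDiffAt_extChartAt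
  have hc2 : ContMDiffAt I 𝓘(ℝ, E) 2 (extChartAt I p.proj) p.proj := contMDiffAt_extChartAt
  have hV' := mdifferentiableAt_completeLift (p := p) hV
  have hW' := mdifferentiableAt_verticalLift (p := p) (hW.of_le (by norm_num))
  have hcV := contMDiffAt_lieDeriv (n := 2) (hc.of_le (by norm_num)) hV.contMDiffAt
  have hcW := contMDiffAt_lieDeriv (n := 2) (hc.of_le (by norm_num)) hW.contMDiffAt
  refine tangent_ext_lieDeriv ?_ ?_
  · rw [lieDeriv_mlieBracket_eq (contMDiffAt_comp_proj hc2) hV' hW'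
      (lieDeriv_completeLift_comp_proj hc2) (lieDeriv_verticalLift_comp_proj hc2),
      (lieDeriv_verticalLift_comp_proj hcV).eq_of_nhds,
      (lieDeriv_verticalLift_comp_proj hc2).eq_of_nhds]
    rw [lieDeriv_const, sub_zero]
  · rw [lieDeriv_mlieBracket_eq (contMDiffAt_differential (n := 2) (hc.of_le (by norm_num))) hV' hW'
      (lieDeriv_completeLift_differential hc2 (hV.mdifferentiable two_ne_zero))
      (lieDeriv_verticalLift_differential hc2),
      (lieDeriv_completeLift_comp_proj hcW).eq_of_nhds,
      (lieDeriv_verticalLift_differential hcV).eq_of_nhds,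
      (lieDeriv_verticalLift_differential hc2).eq_of_nhds,
      lieDeriv_mlieBracket hc2 (hV.contMDiffAt.of_le (by norm_num))
        (hW.contMDiffAt.of_le (by norm_num))]

/-- On `k ∘ π` both sides give `([V,W]k) ∘ π`, and on `dk` both give `d(VWk - WVk)`. The chart is
taken `C³` so that `Vk` and `Wk` are `C²` and the derivation rules apply to them too. -/
theorem mlieBracket_completeLift_completeLift :
    mlieBracket I.tangent (completeLift V) (completeLift W) p =
      completeLift (mlieBracket I V W) p := by
  have hc : ContMDiffAt I 𝓘(ℝ, E) 3 (extChartAt I p.proj) p.proj := contMDiffAt_extChartAt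
  have hc2 : ContMDiffAt I 𝓘(ℝ, E) 2 (extChartAt I p.proj) p.proj := contMDiffAt_extChartAt
  have hV' := mdifferentiableAt_completeLift (p := p) hV
  have hW' := mdifferentiableAt_completeLift (p := p) hW
  have hcV := contMDiffAt_lieDeriv (n := 2) (hc.of_le (by norm_num)) hV.contMDiffAt
  have hcW := contMDiffAt_lieDeriv (n := 2) (hc.of_le (by norm_num)) hW.contMDiffAt
  have hVW : MDifferentiable I I.tangent
      (fun y => (TotalSpace.mk' E y (mlieBracket I V W y) : TangentBundle I M)) := fun y =>
    have : IsManifold I ((2 : ℕ∞) + 1) M := .of_le (n := ∞) (by exact_mod_cast le_top)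
    have : IsManifold I (minSmoothness ℝ 2) M := .of_le (n := 2) (by simp)
    (ContMDiffAt.mlieBracket_vectorField (m := 1) (n := 2) hV.contMDiffAt hW.contMDiffAt
      (by norm_num)).mdifferentiableAt (by simp)
  refine tangent_ext_lieDeriv ?_ ?_
  · rw [lieDeriv_mlieBracket_eq (contMDiffAt_comp_proj hc2) hV' hW'
      (lieDeriv_completeLift_comp_proj hc2) (lieDeriv_completeLift_comp_proj hc2),
      (lieDeriv_completeLift_comp_proj hcV).eq_of_nhds,
      (lieDeriv_completeLift_comp_proj hcW).eq_of_nhds,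
      (lieDeriv_completeLift_comp_proj hc2).eq_of_nhds,
      lieDeriv_mlieBracket hc2 (hV.contMDiffAt.of_le (by norm_num))
        (hW.contMDiffAt.of_le (by norm_num))]
  · rw [lieDeriv_mlieBracket_eq (contMDiffAt_differential (n := 2) (hc.of_le (by norm_num))) hV' hW'
      (lieDeriv_completeLift_differential hc2 (hV.mdifferentiable two_ne_zero))
      (lieDeriv_completeLift_differential hc2 (hW.mdifferentiable two_ne_zero)),
      (lieDeriv_completeLift_differential hcV (hW.mdifferentiable two_ne_zero)).eq_of_nhds,
      (lieDeriv_completeLift_differential hcW (hV.mdifferentiable two_ne_zero)).eq_of_nhds,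
      (lieDeriv_completeLift_differential hc2 hVW).eq_of_nhds]
    -- The commutator identity is needed near the base point, since its differential is taken.
    have h1 : lieDeriv (mlieBracket I V W) (extChartAt I p.proj) =ᶠ[nhds p.proj]
        fun y => lieDeriv V (lieDeriv W (extChartAt I p.proj)) y -
          lieDeriv W (lieDeriv V (extChartAt I p.proj)) y := by
      filter_upwards [eventually_contMDiffAt (n := 2) hc2] with y hy
      exact lieDeriv_mlieBracket hy (hV.contMDiffAt.of_le (by norm_num))
        (hW.contMDiffAt.of_le (by norm_num))
    have h2 := (contMDiffAt_lieDeriv (n := 1) hcW (hV.contMDiffAt.of_le (by norm_num))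
      ).mdifferentiableAt (by simp)
    have h3 := (contMDiffAt_lieDeriv (n := 1) hcV (hW.contMDiffAt.of_le (by norm_num))
      ).mdifferentiableAt (by simp)
    refine ((mvfderiv_congr h1 _).trans ?_).symm
    exact DFunLike.congr_fun (mvfderiv_fun_sub h2 h3) p.snd

end LiftBrackets

/-! ### The Koszul formula -/

section Koszul

variable [FiniteDimensional ℝ E] {M : Type*} [TopologicalSpace M] [ChartedSpace H M]
  [IsManifold I ∞ M]

/-- The Koszul formula, for vector fields whose mutual inner products are constant. -/
theorem IsLeviCivita.koszul_of_const
    {g : ContMDiffRiemannianMetric I ∞ E (TangentSpace I : M → Type _)}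
    {nabla : CovariantDerivative I E (TangentSpace I : M → Type _)} (h : IsLeviCivita g nabla)
    {A B C : Π x : M, TangentSpace I x} {x : M}
    (hA : MDifferentiableAt I I.tangent (fun y => (TotalSpace.mk' E y (A y) : TangentBundle I M)) x)
    (hB : MDifferentiableAt I I.tangent (fun y => (TotalSpace.mk' E y (B y) : TangentBundle I M)) x)
    (hC : MDifferentiableAt I I.tangent (fun y => (TotalSpace.mk' E y (C y) : TangentBundle I M)) x)
    {a b c : ℝ} (hBC : ∀ y, g.inner y (B y) (C y) = a) (hCA : ∀ y, g.inner y (C y) (A y) = b)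
    (hAB : ∀ y, g.inner y (A y) (B y) = c) :
    2 * g.inner x (nabla B x (A x)) (C x) =
      g.inner x (mlieBracket I A B x) (C x) - g.inner x (mlieBracket I B C x) (A x) +
        g.inner x (mlieBracket I C A x) (B x) := by
  -- A constant inner product has zero derivative, so metric compatibility becomes a skewness
  -- relation.
  have comp {P Q : Π x : M, TangentSpace I x} {d : ℝ}
      (hP : MDifferentiableAt I I.tangent
        (fun y => (TotalSpace.mk' E y (P y) : TangentBundle I M)) x)
      (hQ : MDifferentiableAt I I.tangent
        (fun y => (TotalSpace.mk' E y (Q y) : TangentBundle I M)) x)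
      (hPQ : ∀ y, g.inner y (P y) (Q y) = d) (v : TangentSpace I x) :
      g.inner x (nabla P x v) (Q x) + g.inner x (P x) (nabla Q x v) = 0 := by
    rw [← h.compatible hP hQ v, funext hPQ]
    exact DFunLike.congr_fun (mvfderiv_const d) v
  have tors {P Q : Π x : M, TangentSpace I x}
      (hP : MDifferentiableAt I I.tangent
        (fun y => (TotalSpace.mk' E y (P y) : TangentBundle I M)) x)
      (hQ : MDifferentiableAt I I.tangent
        (fun y => (TotalSpace.mk' E y (Q y) : TangentBundle I M)) x) :
      mlieBracket I P Q x = nabla Q x (P x) - nabla P x (Q x) := by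
    have := nabla.torsion_apply hP hQ
    rw [h.torsion_free] at this
    exact (sub_eq_zero.1 this.symm).symm
  have h1 := comp hB hC hBC (A x)
  have h2 := comp hC hA hCA (B x)
  have h3 := comp hA hB hAB (C x)
  rw [tors hA hB, tors hB hC, tors hC hA]
  simp only [map_sub, sub_apply]
  rw [g.symm x (B x)] at h1
  rw [g.symm x (C x)] at h2
  rw [g.symm x (A x)] at h3
  linarith

end Koszul

/-! ### Left-invariant fields and metrics on the group -/

section LeftInvariantFields

variable [FiniteDimensional ℝ E] {G : Type*} [TopologicalSpace G] [ChartedSpace H G] [Group G]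
  [LieGroup I ∞ G]

omit [FiniteDimensional ℝ E] in
theorem contMDiff_two_mulInvariantVectorField (X : GroupLieAlgebra I G) :
    ContMDiff I I.tangent 2
      (fun x => (TotalSpace.mk' E x (mulInvariantVectorField X x) : TangentBundle I G)) :=
  (contMDiff_mulInvariantVectorField X).of_le le_minSmoothness

theorem mlieBracket_mulInvariantVectorField (X Y : GroupLieAlgebra I G) :
    mlieBracket I (mulInvariantVectorField X) (mulInvariantVectorField Y) =
      mulInvariantVectorField (I := I) (G := G) ⁅X, Y⁆ :=
  have := FiniteDimensional.complete ℝ E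
  (mulInvariantVector_mlieBracket X Y).symm

omit [FiniteDimensional ℝ E] [LieGroup I ∞ G] in
theorem mulInvariantVectorField_apply_one (X : GroupLieAlgebra I G) :
    mulInvariantVectorField X (1 : G) = X := by
  have h : (fun y : G => 1 * y) = id := funext one_mul
  have h2 : (mfderiv I I (fun y : G => 1 * y) 1 : E →L[ℝ] E) = ContinuousLinearMap.id ℝ E := by
    rw [h]
    exact mfderiv_id
  exact DFunLike.congr_fun h2 X

/-- Translation by `x⁻¹` undoes translation by `x`, so the derivative of the latter at the identity
is injective, hence surjective by finite dimension. -/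
theorem exists_mulInvariantVectorField_eq {x : G} (v : TangentSpace I x) :
    ∃ X : GroupLieAlgebra I G, mulInvariantVectorField X x = v := by
  have hd (a b : G) : MDifferentiableAt I I (fun y => a * y) b :=
    (contMDiff_mul_left (I := I) (n := ∞)).mdifferentiableAt (by simp)
  have h := mfderiv_comp (1 : G) (hd x⁻¹ (x * 1)) (hd x 1)
  have h2 : (fun y : G => x⁻¹ * y) ∘ (fun y => x * y) = id := by
    funext y
    simp
  rw [h2, mfderiv_id] at h
  obtain ⟨L, hL⟩ : ∃ L : E →L[ℝ] E, L = mfderiv I I (fun y => x * y) (1 : G) := ⟨_, rfl⟩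
  have hinj : Function.Injective L :=
    Function.LeftInverse.injective
      (g := (mfderiv I I (fun y => x⁻¹ * y) (x * 1) : E →L[ℝ] E))
      fun w => by
        rw [hL]
        exact (DFunLike.congr_fun h w).symm
  obtain ⟨X, hX⟩ := (LinearMap.injective_iff_surjective (f := L.toLinearMap)).1 hinj v
  exact ⟨X, (DFunLike.congr_fun hL X).symm.trans hX⟩

omit [FiniteDimensional ℝ E] in
theorem IsLeftInvariant.inner_mulInvariantVectorField
    {g : ContMDiffRiemannianMetric I ∞ E (TangentSpace I : G → Type _)} (hg : IsLeftInvariant g)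
    (X Y : GroupLieAlgebra I G) (x : G) :
    g.inner x (mulInvariantVectorField X x) (mulInvariantVectorField Y x) = lieInner g X Y :=
  (congrArg (fun z => (g.inner z : E →L[ℝ] E →L[ℝ] ℝ) (mulInvariantVectorField X x)
    (mulInvariantVectorField Y x)) (mul_one x)).symm.trans (hg x 1 X Y)

omit [FiniteDimensional ℝ E] in
theorem lieInner_comm (g : ContMDiffRiemannianMetric I ∞ E (TangentSpace I : G → Type _))
    (X Y : GroupLieAlgebra I G) : lieInner g X Y = lieInner g Y X :=
  g.symm 1 X Y

theorem lieInner_ext {g : ContMDiffRiemannianMetric I ∞ E (TangentSpace I : G → Type _)}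
    {X Y : GroupLieAlgebra I G} (h : ∀ Z, lieInner g X Z = lieInner g Y Z) : X = Y :=
  sub_eq_zero.1 ((lieInner_nondegenerate g).1 _ fun Z => by
    rw [map_sub, LinearMap.sub_apply, h, sub_self])

theorem IsLeftInvariant.koszul
    {g : ContMDiffRiemannianMetric I ∞ E (TangentSpace I : G → Type _)} (hg : IsLeftInvariant g)
    {nabla : CovariantDerivative I E (TangentSpace I : G → Type _)} (h : IsLeviCivita g nabla)
    (X Y Z : GroupLieAlgebra I G) (x : G) :
    2 * g.inner x (covField nabla X Y x) (mulInvariantVectorField Z x) =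
      lieInner g ⁅X, Y⁆ Z - lieInner g ⁅Y, Z⁆ X + lieInner g ⁅Z, X⁆ Y := by
  have hd (X : GroupLieAlgebra I G) := (contMDiff_two_mulInvariantVectorField X
    ).mdifferentiable two_ne_zero x
  have := h.koszul_of_const (hd X) (hd Y) (hd Z) (hg.inner_mulInvariantVectorField Y Z)
    (hg.inner_mulInvariantVectorField Z X) (hg.inner_mulInvariantVectorField X Y)
  simp only [mlieBracket_mulInvariantVectorField, hg.inner_mulInvariantVectorField] at this
  exact this

/-- The value at the identity of `∇_X Y`. -/
def lieCov (nabla : CovariantDerivative I E (TangentSpace I : G → Type _))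
    (X Y : GroupLieAlgebra I G) : GroupLieAlgebra I G :=
  covField nabla X Y 1

theorem IsLeftInvariant.koszul_one
    {g : ContMDiffRiemannianMetric I ∞ E (TangentSpace I : G → Type _)} (hg : IsLeftInvariant g)
    {nabla : CovariantDerivative I E (TangentSpace I : G → Type _)} (h : IsLeviCivita g nabla)
    (X Y Z : GroupLieAlgebra I G) :
    2 * lieInner g (lieCov nabla X Y) Z =
      lieInner g ⁅X, Y⁆ Z - lieInner g ⁅Y, Z⁆ X + lieInner g ⁅Z, X⁆ Y := by
  have h1 := hg.koszul h X Y Z 1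
  rwa [mulInvariantVectorField_apply_one] at h1

/-- The right side of the Koszul formula does not depend on `x`, so `∇_X Y` has the same components
in the left-invariant frame at every point. -/
theorem IsLeftInvariant.covField_eq
    {g : ContMDiffRiemannianMetric I ∞ E (TangentSpace I : G → Type _)} (hg : IsLeftInvariant g)
    {nabla : CovariantDerivative I E (TangentSpace I : G → Type _)} (h : IsLeviCivita g nabla)
    (X Y : GroupLieAlgebra I G) :
    covField nabla X Y = mulInvariantVectorField (lieCov nabla X Y) := by
  funext x
  obtain ⟨W, hW⟩ := exists_mulInvariantVectorField_eq (covField nabla X Y x)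
  have h1 : W = lieCov nabla X Y := lieInner_ext (g := g) fun Z => by
    have h2 := hg.koszul h X Y Z x
    rw [← hW, hg.inner_mulInvariantVectorField] at h2
    have h3 := hg.koszul_one h X Y Z
    linarith
  rw [← h1, hW]

end LeftInvariantFields

/-! ### The frame of complete and vertical lifts on `TG` -/

section LiftedMetric

variable [FiniteDimensional ℝ E] [I.Boundaryless] {G : Type*} [TopologicalSpace G]
  [ChartedSpace H G] [Group G] [LieGroup I ∞ G]
  {g₁ g₂ : ContMDiffRiemannianMetric I ∞ E (TangentSpace I : G → Type _)}
  {gT : ContMDiffRiemannianMetric I.tangent ∞ (E × E)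
    (TangentSpace I.tangent : TangentBundle I G → Type _)}

/-- The complete lift of the left-invariant field determined by `X`. -/
def completeField (X : GroupLieAlgebra I G) (p : TangentBundle I G) : TangentSpace I.tangent p :=
  completeLift (mulInvariantVectorField X) p

/-- The vertical lift of the left-invariant field determined by `X`. -/
def verticalField (X : GroupLieAlgebra I G) (p : TangentBundle I G) : TangentSpace I.tangent p :=
  verticalLift (mulInvariantVectorField X) p

omit [FiniteDimensional ℝ E] in
theorem mdifferentiableAt_completeField (X : GroupLieAlgebra I G) (p : TangentBundle I G) :
    MDifferentiableAt I.tangent I.tangent.tangent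
      (fun q => (TotalSpace.mk' (E × E) q (completeField X q) :
        TangentBundle I.tangent (TangentBundle I G))) p :=
  mdifferentiableAt_completeLift (contMDiff_two_mulInvariantVectorField X)

omit [FiniteDimensional ℝ E] in
theorem mdifferentiableAt_verticalField (X : GroupLieAlgebra I G) (p : TangentBundle I G) :
    MDifferentiableAt I.tangent I.tangent.tangent
      (fun q => (TotalSpace.mk' (E × E) q (verticalField X q) :
        TangentBundle I.tangent (TangentBundle I G))) p :=
  mdifferentiableAt_verticalLift ((contMDiff_two_mulInvariantVectorField X).of_le (by norm_num))

theorem mlieBracket_completeField_completeField (X Y : GroupLieAlgebra I G)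
    (p : TangentBundle I G) :
    mlieBracket I.tangent (completeField X) (completeField Y) p = completeField ⁅X, Y⁆ p := by
  have := FiniteDimensional.complete ℝ E
  rw [completeField, ← mlieBracket_mulInvariantVectorField]
  exact mlieBracket_completeLift_completeLift (contMDiff_two_mulInvariantVectorField X)
    (contMDiff_two_mulInvariantVectorField Y)

theorem mlieBracket_completeField_verticalField (X Y : GroupLieAlgebra I G)
    (p : TangentBundle I G) :
    mlieBracket I.tangent (completeField X) (verticalField Y) p = verticalField ⁅X, Y⁆ p := by
  have := FiniteDimensional.complete ℝ E
  rw [verticalField, ← mlieBracket_mulInvariantVectorField]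
  exact mlieBracket_completeLift_verticalLift (contMDiff_two_mulInvariantVectorField X)
    (contMDiff_two_mulInvariantVectorField Y)

theorem mlieBracket_verticalField_completeField (X Y : GroupLieAlgebra I G)
    (p : TangentBundle I G) :
    mlieBracket I.tangent (verticalField X) (completeField Y) p = -verticalField ⁅Y, X⁆ p := by
  rw [mlieBracket_swap_apply, mlieBracket_completeField_verticalField]

theorem mlieBracket_verticalField_verticalField (X Y : GroupLieAlgebra I G)
    (p : TangentBundle I G) :
    mlieBracket I.tangent (verticalField X) (verticalField Y) p = 0 := by
  have := FiniteDimensional.complete ℝ E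
  exact mlieBracket_verticalLift_verticalLift (contMDiff_two_mulInvariantVectorField X)
    (contMDiff_two_mulInvariantVectorField Y)

omit [I.Boundaryless] in
-- A complete lift matches the horizontal part; the remaining error lies along the fibre, where
-- vertical lifts give everything.
theorem exists_completeField_add_verticalField {p : TangentBundle I G}
    (ξ : TangentSpace I.tangent p) :
    ∃ Z W : GroupLieAlgebra I G, ξ = completeField Z p + verticalField W p := by
  obtain ⟨Z, hZ⟩ := exists_mulInvariantVectorField_eq (horizontal ξ)
  obtain ⟨W, hW⟩ := exists_mulInvariantVectorField_eq
    (vertical ξ - vertical (completeField Z p))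
  refine ⟨Z, W, ?_⟩
  rw [verticalField, verticalLift_eq, hW]
  have h1 : horizontal ξ = horizontal (completeField Z p) + 0 := by
    rw [add_zero]
    exact hZ.symm
  have h2 : vertical ξ = vertical (completeField Z p) +
    (vertical ξ - vertical (completeField Z p)) := by abel
  exact Prod.ext h1 h2

omit [I.Boundaryless] in
-- The two kinds of lifts span and `gT` is positive definite. The factor `2` matches the Koszul
-- formula.
theorem eq_of_inner_fields {p : TangentBundle I G} {ξ η : TangentSpace I.tangent p}
    (hc : ∀ Z, 2 * gT.inner p ξ (completeField Z p) = 2 * gT.inner p η (completeField Z p))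
    (hv : ∀ Z, 2 * gT.inner p ξ (verticalField Z p) = 2 * gT.inner p η (verticalField Z p)) :
    ξ = η := by
  by_contra h
  refine (gT.pos p (ξ - η) (sub_ne_zero.2 h)).ne' ?_
  have key (ζ : TangentSpace I.tangent p) : gT.inner p (ξ - η) ζ = 0 := by
    obtain ⟨Z, W, rfl⟩ := exists_completeField_add_verticalField ζ
    have h1 := hc Z
    have h2 := hv W
    rw [map_add, map_sub, sub_apply, sub_apply]
    linarith
  exact key _

end LiftedMetric

end TangentLie
end

/-! ### The four covariant derivatives -/

theorem theorem2p4
    {E : Type*} [NormedAddCommGroup E] [NormedSpace ℝ E] [FiniteDimensional ℝ E]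
    {H : Type*} [TopologicalSpace H] {I : ModelWithCorners ℝ E H} [I.Boundaryless]
    {G : Type*} [TopologicalSpace G] [ChartedSpace H G] [Group G] [LieGroup I ∞ G]
    (g₁ g₂ : ContMDiffRiemannianMetric I ∞ E (TangentSpace I : G → Type _))
    (hg₁ : IsLeftInvariant g₁) (hg₂ : IsLeftInvariant g₂)
    (gT : ContMDiffRiemannianMetric I.tangent ∞ (E × E)
      (TangentSpace I.tangent : TangentBundle I G → Type _))
    (hgT : IsLiftedMetric g₁ g₂ gT)
    (nabla₁ nabla₂ : CovariantDerivative I E (TangentSpace I : G → Type _))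
    (h₁ : IsLeviCivita g₁ nabla₁) (h₂ : IsLeviCivita g₂ nabla₂)
    (nablaT : CovariantDerivative I.tangent (E × E)
      (TangentSpace I.tangent : TangentBundle I G → Type _))
    (hT : IsLeviCivita gT nablaT)
    (X Y : GroupLieAlgebra I G) (p : TangentBundle I G) :
    nablaT (completeLift (mulInvariantVectorField Y)) p
        (completeLift (mulInvariantVectorField X) p) =
      completeLift (covField nabla₁ X Y) p ∧
    nablaT (verticalLift (mulInvariantVectorField Y)) p
        (completeLift (mulInvariantVectorField X) p) =
      verticalLift (covField nabla₂ X Y +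
        mulInvariantVectorField ((1 / 2 : ℝ) • adTranspose g₂ Y X)) p ∧
    nablaT (completeLift (mulInvariantVectorField Y)) p
        (verticalLift (mulInvariantVectorField X) p) =
      verticalLift (covField nabla₂ X Y +
        mulInvariantVectorField ((1 / 2 : ℝ) • adTranspose g₂ X Y)) p ∧
    nablaT (verticalLift (mulInvariantVectorField Y)) p
        (verticalLift (mulInvariantVectorField X) p) =
      completeLift (mulInvariantVectorField
        (phi g₁ g₂ (covField nabla₂ X Y 1 - (1 / 2 : ℝ) • ⁅X, Y⁆))) p := by
  have hd1 := mdifferentiableAt_completeField (I := I) (G := G) (p := p)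
  have hd2 := mdifferentiableAt_verticalField (I := I) (G := G) (p := p)
  have hcc (X Y : GroupLieAlgebra I G) (q : TangentBundle I G) :
      gT.inner q (completeField X q) (completeField Y q) = lieInner g₁ X Y :=
    hgT.complete_complete X Y q
  have hvv (X Y : GroupLieAlgebra I G) (q : TangentBundle I G) :
      gT.inner q (verticalField X q) (verticalField Y q) = lieInner g₂ X Y :=
    hgT.vertical_vertical X Y q
  have hcv (X Y : GroupLieAlgebra I G) (q : TangentBundle I G) :
      gT.inner q (completeField X q) (verticalField Y q) = 0 := hgT.complete_vertical X Y q
  have hvc (X Y : GroupLieAlgebra I G) (q : TangentBundle I G) :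
      gT.inner q (verticalField X q) (completeField Y q) = 0 := by rw [gT.symm, hcv]
  rw [hg₁.covField_eq h₁, hg₂.covField_eq h₂, ← mulInvariantVectorField_add,
    ← mulInvariantVectorField_add]
  change nablaT (completeField Y) p (completeField X p) = completeField (lieCov nabla₁ X Y) p ∧
    nablaT (verticalField Y) p (completeField X p) =
      verticalField (lieCov nabla₂ X Y + (1 / 2 : ℝ) • adTranspose g₂ Y X) p ∧
    nablaT (completeField Y) p (verticalField X p) =
      verticalField (lieCov nabla₂ X Y + (1 / 2 : ℝ) • adTranspose g₂ X Y) p ∧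
    nablaT (verticalField Y) p (verticalField X p) =
      completeField (phi g₁ g₂
        (mulInvariantVectorField (lieCov nabla₂ X Y) 1 - (1 / 2 : ℝ) • ⁅X, Y⁆)) p
  rw [mulInvariantVectorField_apply_one]
  have skew (g : ContMDiffRiemannianMetric I ∞ E (TangentSpace I : G → Type _))
      (A B C : GroupLieAlgebra I G) : lieInner g ⁅A, B⁆ C = -lieInner g ⁅B, A⁆ C := by
    rw [← lie_skew, map_neg, LinearMap.neg_apply]
  refine ⟨eq_of_inner_fields (gT := gT) (fun Z => ?_) (fun Z => ?_),
    eq_of_inner_fields (gT := gT) (fun Z => ?_) (fun Z => ?_),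
    eq_of_inner_fields (gT := gT) (fun Z => ?_) (fun Z => ?_),
    eq_of_inner_fields (gT := gT) (fun Z => ?_) (fun Z => ?_)⟩
  · have h := hT.koszul_of_const (hd1 X) (hd1 Y) (hd1 Z) (hcc Y Z) (hcc Z X) (hcc X Y)
    simp only [mlieBracket_completeField_completeField, hcc] at h
    rw [h, hcc, hg₁.koszul_one h₁]
  -- With exactly one vertical argument, each Koszul term pairs a complete lift with a vertical one
  -- and vanishes.
  · have h := hT.koszul_of_const (hd1 X) (hd1 Y) (hd2 Z) (hcv Y Z) (hvc Z X) (hcc X Y)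
    simp only [mlieBracket_completeField_completeField, mlieBracket_completeField_verticalField,
      mlieBracket_verticalField_completeField, map_neg, neg_apply,
      hcv, hvc] at h
    rw [h, hcv]
    simp
  · have h := hT.koszul_of_const (hd1 X) (hd2 Y) (hd1 Z) (hvc Y Z) (hcc Z X) (hcv X Y)
    simp only [mlieBracket_completeField_completeField, mlieBracket_completeField_verticalField,
      mlieBracket_verticalField_completeField, map_neg, neg_apply,
      hcv, hvc] at h
    rw [h, hvc]
    simp
  -- Here `[Y^v, Z^v] = 0` removes `-⟨[Y,Z], X⟩₂` from the Koszul sum of `g₂`; adding `⟨(ad₂Y)^* X,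
  -- Z⟩₂` does the same.
  · have h := hT.koszul_of_const (hd1 X) (hd2 Y) (hd2 Z) (hvv Y Z) (hvc Z X) (hcv X Y)
    simp only [mlieBracket_verticalField_verticalField, mlieBracket_completeField_verticalField,
      mlieBracket_verticalField_completeField, map_neg, neg_apply,
      map_zero, zero_apply, hvv] at h
    have h2 := hg₂.koszul_one h₂ X Y Z
    rw [h, hvv, map_add, map_smul, LinearMap.add_apply, LinearMap.smul_apply, adTranspose_spec,
      mul_add, h2, lieInner_comm g₂ X, smul_eq_mul]
    linarith [skew g₂ Z X Y]
  · have h := hT.koszul_of_const (hd2 X) (hd1 Y) (hd1 Z) (hcc Y Z) (hcv Z X) (hvc X Y)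
    simp only [mlieBracket_completeField_completeField, mlieBracket_completeField_verticalField,
      mlieBracket_verticalField_completeField, map_neg, neg_apply,
      hcv, hvc] at h
    rw [h, hvc]
    simp
  -- The missing term is now `⟨[Z,X], Y⟩₂`, cancelled by `⟨(ad₂X)^* Y, Z⟩₂`.
  · have h := hT.koszul_of_const (hd2 X) (hd1 Y) (hd2 Z) (hcv Y Z) (hvv Z X) (hvc X Y)
    simp only [mlieBracket_verticalField_verticalField, mlieBracket_completeField_verticalField,
      mlieBracket_verticalField_completeField, map_neg, neg_apply,
      map_zero, zero_apply, hvv] at h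
    have h2 := hg₂.koszul_one h₂ X Y Z
    rw [h, hvv, map_add, map_smul, LinearMap.add_apply, LinearMap.smul_apply, adTranspose_spec,
      mul_add, h2, lieInner_comm g₂ Y, smul_eq_mul]
    linarith [skew g₂ Z X Y, skew g₂ X Y Z]
  -- The missing term is `⟨[X,Y], Z⟩₂`, whence `-½[X,Y]`; `phi_spec` trades the `g₁` pairing of
  -- complete lifts for `g₂`.
  · have h := hT.koszul_of_const (hd2 X) (hd2 Y) (hd1 Z) (hvc Y Z) (hcv Z X) (hvv X Y)
    simp only [mlieBracket_verticalField_verticalField, mlieBracket_completeField_verticalField,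
      mlieBracket_verticalField_completeField, map_neg, neg_apply,
      map_zero, zero_apply, hvv] at h
    have h2 := hg₂.koszul_one h₂ X Y Z
    rw [h, hcc, phi_spec, map_sub, map_smul, LinearMap.sub_apply, LinearMap.smul_apply,
      mul_sub, h2, smul_eq_mul]
    linarith [skew g₂ Z Y X]
  -- Three vertical arguments: all brackets are zero.
  · have h := hT.koszul_of_const (hd2 X) (hd2 Y) (hd2 Z) (hvv Y Z) (hvv Z X) (hvv X Y)
    simp only [mlieBracket_verticalField_verticalField, map_zero,
      zero_apply] at h
    rw [h, hcv]
    simp
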